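/- Let $E$ be a locally compact separable metric space with Borel $\sigma$-algebra, let $m$ be a $\sigma$-finite Borel measure on $E$ with full support, and let $(P_t)_{t\ge 0}$ be a sub-Markovian transition function on $E$ (for instance the one of a Borel right Markov process): each $P_t(x,dy)$ is a kernel with $P_t(x,E)\le 1$, $P_0(x,\cdot)=\delta_x$ and $P_{s+t}=P_sP_t$. Suppose that $(P_t)$ extends to a strongly continuous semigroup of bounded operators on the real Hilbert space $L^2(m)=L^2(E,m)$, again denoted $(P_t)$, which is symmetric, i.e. $(P_tf,g)=(f,P_tg)$ for all $f,g\in L^2(m)$, and sub-Markovian, i.e. $0\le f\le 1$ $m$-a.e. implies $0\le P_tf\le 1$ $m$-a.e. Let $\alpha>0$ and define, for $f\in L^2(m)$ and $t\ge 0$, the Bochner integrals in $L^2(m)$ $$U^\alpha f=\int_0^\infty e^{-\alpha s}P_sf\,ds,\qquad \mathcal J^\alpha_tf=\int_0^\infty J_0(2\sqrt{ts})\,e^{-\alpha s}P_sf\,ds,$$ where $J_0(x)=\sum_{k\ge 0}\frac{(-1)^k}{(k!)^2}(x/2)^{2k}$ is the Bessel function of the first kind of order $0$. The operator $U^\alpha$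 is bounded on $L^2(m)$. Let $f\in L^2(m)$. Then the integral defining $\mathcal J^\alpha_tf$ converges absolutely for every $t\ge 0$, and the Cauchy problem $$\frac{d}{dt}j(t)=-U^\alpha j(t)\quad(t\ge 0),\qquad j(0)=U^\alpha f,$$ for functions $j:[0,\infty)\to L^2(m)$, with the derivative taken in the norm of $L^2(m)$ (one-sided at $t=0$), has a unique solution, namely $j(t)=\mathcal J^\alpha_tf$. Moreover, $$\mathcal J^\alpha_tf=e^{-tU^\alpha}U^\alpha f\qquad\text{for all }t\ge 0,$$ where $e^{-tU^\alpha}$ is the exponential of the bounded operator $-tU^\alpha$. -/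

import Mathlib

open MeasureTheory ProbabilityTheory Filter Topology Set
open scoped NNReal ENNReal

/-- A sub-Markovian transition function `(P_t)_{t ≥ 0}` on `E`: a family of sub-probability kernels
`P_t(x, dy)` with `P_0(x, ·) = δ_x` and the Chapman-Kolmogorov equations `P_{s+t} = P_s P_t`. -/
structure IsSubMarkovTransitionFunction {E : Type*} [MeasurableSpace E]
    (P : ℝ≥0 → Kernel E E) : Prop where
  zero : P 0 = Kernel.id
  measure_univ_le_one : ∀ t x, P t x univ ≤ 1
  chapman_kolmogorov : ∀ s t, P (s + t) = (P s).comp (P t)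

/-- An extension of the transition function `P` to a strongly continuous, sub-Markovian,
symmetric semigroup `(op t)_{t ≥ 0}` of bounded operators on the real Hilbert space `L²(m)`. -/
structure SymmetricL2Extension {E : Type*} [MeasurableSpace E]
    (P : ℝ≥0 → Kernel E E) (m : Measure E) where
  /-- The operator `P_t` on `L²(m)`. -/
  op : ℝ≥0 → Lp ℝ 2 m →L[ℝ] Lp ℝ 2 m
  /-- On bounded measurable square-integrable functions, `op t` is integration against the
  kernel `P_t(x, dy)`. -/
  extends_kernel : ∀ (t : ℝ≥0) (f : E → ℝ), Measurable f → (∃ C, ∀ x, |f x| ≤ C) →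
    ∀ hf : MemLp f 2 m, op t (hf.toLp f) =ᵐ[m] fun x => ∫ y, f y ∂(P t x)
  op_zero : op 0 = 1
  op_add : ∀ s t, op (s + t) = op s * op t
  tendsto_zero : ∀ f, Tendsto (fun t => op t f) (𝓝[>] 0) (𝓝 f)
  symm : ∀ t f g, inner ℝ (op t f) g = inner ℝ f (op t g)
  subMarkov : ∀ t (f : Lp ℝ 2 m), (∀ᵐ x ∂m, f x ∈ Icc (0 : ℝ) 1) →
    ∀ᵐ x ∂m, op t f x ∈ Icc (0 : ℝ) 1

/-- The Bessel function of the first kind of order `0`,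
`J₀(x) = ∑ₖ (-1)ᵏ (x/2)²ᵏ / (k!)²`. -/
noncomputable def besselJ0 (x : ℝ) : ℝ :=
  ∑' k : ℕ, (-1) ^ k * (x / 2) ^ (2 * k) / ((k.factorial : ℝ) ^ 2)

namespace SymmetricL2Extension

section Contraction

variable {E : Type*} [MeasurableSpace E] {P : ℝ≥0 → Kernel E E} {m : Measure E}

theorem ae_abs_le (S : SymmetricL2Extension P m) (t : ℝ≥0) (f : Lp ℝ 2 m) (C : ℝ) (hC : 0 < C)
    (hf : ∀ᵐ x ∂m, |f x| ≤ C) : ∀ᵐ x ∂m, |S.op t f x| ≤ C := by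
  have key : ∀ g : Lp ℝ 2 m, (∀ᵐ x ∂m, g x ∈ Icc (0 : ℝ) C) →
      ∀ᵐ x ∂m, S.op t g x ∈ Icc (0 : ℝ) C := by
    intro g hg
    have h1 : ∀ᵐ x ∂m, (C⁻¹ • g : Lp ℝ 2 m) x ∈ Icc (0 : ℝ) 1 := by
      filter_upwards [hg, Lp.coeFn_smul C⁻¹ g] with x hx hx2
      rw [hx2, Pi.smul_apply, smul_eq_mul]
      refine ⟨mul_nonneg (inv_nonneg.2 hC.le) hx.1, ?_⟩
      rw [inv_mul_le_iff₀ hC, mul_one]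
      exact hx.2
    have h2 := S.subMarkov t _ h1
    rw [map_smul] at h2
    filter_upwards [h2, Lp.coeFn_smul C⁻¹ (S.op t g)] with x hx hx2
    rw [hx2, Pi.smul_apply, smul_eq_mul] at hx
    obtain ⟨h3, h4⟩ := hx
    rw [inv_mul_le_iff₀ hC, mul_one] at h4
    refine ⟨?_, h4⟩
    by_contra hneg
    push Not at hneg
    exact absurd h3 (not_le.2 (mul_neg_of_pos_of_neg (inv_pos.2 hC) hneg))
  have hp : ∀ᵐ x ∂m, (Lp.posPart f : Lp ℝ 2 m) x ∈ Icc (0 : ℝ) C := by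
    filter_upwards [hf, Lp.coeFn_posPart f] with x hx hx2
    rw [hx2]
    exact ⟨le_max_right _ _, max_le (le_of_abs_le hx) hC.le⟩
  have hn : ∀ᵐ x ∂m, (Lp.negPart f : Lp ℝ 2 m) x ∈ Icc (0 : ℝ) C := by
    filter_upwards [hf, Lp.coeFn_negPart_eq_max f] with x hx hx2
    rw [hx2]
    exact ⟨le_max_right _ _, max_le (neg_le.1 (abs_le.1 hx).1) hC.le⟩
  have hdec : f = Lp.posPart f - Lp.negPart f := by
    apply Lp.ext
    filter_upwards [Lp.coeFn_posPart f, Lp.coeFn_negPart_eq_max f,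
      Lp.coeFn_sub (Lp.posPart f) (Lp.negPart f)] with x h1 h2 h3
    rw [h3, Pi.sub_apply, h1, h2]
    rcases le_total 0 (f x) with h | h
    · rw [max_eq_left h, max_eq_right (by linarith)]; ring
    · rw [max_eq_right h, max_eq_left (by linarith)]; ring
  have hop : S.op t f = S.op t (Lp.posPart f) - S.op t (Lp.negPart f) := by
    rw [← map_sub, ← hdec]
  filter_upwards [key _ hp, key _ hn,
    Lp.coeFn_sub (S.op t (Lp.posPart f)) (S.op t (Lp.negPart f))] with x h1 h2 h3
  rw [hop, h3, Pi.sub_apply, abs_le]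
  constructor <;> linarith [h1.1, h1.2, h2.1, h2.2]

theorem norm_sq_eq (S : SymmetricL2Extension P m) (t : ℝ≥0) (f : Lp ℝ 2 m) :
    ‖S.op t f‖ ^ 2 = inner ℝ (S.op (t + t) f) f := by
  rw [← real_inner_self_eq_norm_sq, S.op_add]
  exact (S.symm t (S.op t f) f).symm

theorem exists_bound (S : SymmetricL2Extension P m) (f : Lp ℝ 2 m) (C : ℝ) (hC : 0 < C)
    (hf : ∀ᵐ x ∂m, |f x| ≤ C) (hint : Integrable f m) :
    ∃ K, ∀ t, ‖S.op t f‖ ^ 2 ≤ K := by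
  refine ⟨∫ x, C * |f x| ∂m, fun t => ?_⟩
  rw [norm_sq_eq, L2.inner_def]
  refine integral_mono_ae (L2.integrable_inner _ _) (hint.abs.const_mul C) ?_
  filter_upwards [S.ae_abs_le (t + t) f C hC hf] with x hx
  calc inner ℝ (S.op (t + t) f x) (f x) ≤ |inner ℝ (S.op (t + t) f x) (f x)| := le_abs_self _
    _ ≤ |S.op (t + t) f x| * |f x| := abs_real_inner_le_norm _ _
    _ ≤ C * |f x| := mul_le_mul_of_nonneg_right hx (abs_nonneg _)

theorem norm_op_le_of_bound (S : SymmetricL2Extension P m) (f : Lp ℝ 2 m) (K : ℝ)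
    (hK : ∀ t, ‖S.op t f‖ ^ 2 ≤ K) (t : ℝ≥0) : ‖S.op t f‖ ≤ ‖f‖ := by
  by_contra hlt
  push Not at hlt
  set a : ℕ → ℝ := fun n => ‖S.op (n * t) f‖ with ha
  have a0 : a 0 = ‖f‖ := by simp [ha, S.op_zero]
  have a1 : a 1 = ‖S.op t f‖ := by simp [ha]
  have hlog : ∀ n, a (n + 1) ^ 2 ≤ a (n + 2) * a n := by
    intro n
    have h1 : S.op (((n + 1 : ℕ) : ℝ≥0) * t) f = S.op t (S.op (n * t) f) := by
      have : ((n + 1 : ℕ) : ℝ≥0) * t = t + n * t := by push_cast; ring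
      rw [this, S.op_add]; rfl
    have h2 : S.op (((n + 2 : ℕ) : ℝ≥0) * t) f = S.op t (S.op t (S.op (n * t) f)) := by
      have : ((n + 2 : ℕ) : ℝ≥0) * t = t + (t + n * t) := by push_cast; ring
      rw [this, S.op_add, S.op_add]; rfl
    simp only [ha]
    rw [h1, h2, ← real_inner_self_eq_norm_sq, ← S.symm]
    exact real_inner_le_norm _ _
  have hbd : ∀ n, a n ^ 2 ≤ K := fun n => hK _
  have hpos1 : 0 < a 1 := by rw [a1]; exact lt_of_le_of_lt (norm_nonneg _) hlt
  have ha0pos : 0 < a 0 := by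
    by_contra h0
    have : a 0 = 0 := le_antisymm (not_lt.1 h0) (norm_nonneg _)
    have h := hlog 0
    rw [this, mul_zero] at h
    simp only [zero_add] at h
    nlinarith
  set r := a 1 / a 0 with hr
  have hr1 : 1 < r := by rw [hr, one_lt_div ha0pos, a0, a1]; exact hlt
  have hgrow : ∀ n, 0 < a n ∧ r * a n ≤ a (n + 1) := by
    intro n
    induction n with
    | zero => exact ⟨ha0pos, by rw [hr]; simp [ha0pos.ne']⟩
    | succ n ih =>
      obtain ⟨h1, h2⟩ := ih
      have h3 : 0 < a (n + 1) := lt_of_lt_of_le (by positivity) h2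
      refine ⟨h3, ?_⟩
      have h4 := hlog n
      have h5 : a n * (r * a (n + 1)) ≤ a n * a (n + 2) := by nlinarith
      exact le_of_mul_le_mul_left h5 h1
  have hgeom : ∀ n, r ^ n * a 0 ≤ a n := by
    intro n
    induction n with
    | zero => simp
    | succ n ih =>
      calc r ^ (n + 1) * a 0 = r * (r ^ n * a 0) := by ring
        _ ≤ r * a n := mul_le_mul_of_nonneg_left ih (by linarith)
        _ ≤ a (n + 1) := (hgrow n).2
  obtain ⟨n, hn⟩ := pow_unbounded_of_one_lt ((|K| + 1) / a 0) hr1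
  rw [div_lt_iff₀ ha0pos] at hn
  have h1 := hgeom n
  have h2 := hbd n
  have h3 := le_abs_self K
  have h4 := abs_nonneg K
  nlinarith

/-- Symmetry and the sub-Markov property make every `P_t` a contraction of `L²(m)`. -/
theorem norm_op_apply_le (S : SymmetricL2Extension P m) (t : ℝ≥0) (f : Lp ℝ 2 m) :
    ‖S.op t f‖ ≤ ‖f‖ := by
  have hd : DenseRange ((↑) : Lp.simpleFunc ℝ 2 m → Lp ℝ 2 m) :=
    Lp.simpleFunc.denseRange (by simp)
  refine hd.induction_on (p := fun f => ‖S.op t f‖ ≤ ‖f‖) f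
    (isClosed_le (by fun_prop) (by fun_prop)) ?_
  intro g
  have hae := Lp.simpleFunc.toSimpleFunc_eq_toFun g
  set s := Lp.simpleFunc.toSimpleFunc g with hs
  have hint : Integrable s m :=
    (SimpleFunc.memLp_iff_integrable (by simp) (by simp)).1 (Lp.simpleFunc.memLp g)
  obtain ⟨C, hC⟩ := s.exists_forall_norm_le
  have hC' : ∀ᵐ x ∂m, |(g : Lp ℝ 2 m) x| ≤ |C| + 1 := by
    filter_upwards [hae] with x hx
    rw [← hx]
    have h1 := hC x
    rw [Real.norm_eq_abs] at h1
    linarith [le_abs_self C]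
  obtain ⟨K, hK⟩ := S.exists_bound (g : Lp ℝ 2 m) (|C| + 1) (by positivity) hC' (hint.congr hae)
  exact S.norm_op_le_of_bound _ K hK t

theorem continuous_op_apply (S : SymmetricL2Extension P m) (f : Lp ℝ 2 m) :
    Continuous fun t => S.op t f := by
  have h0 : Tendsto (fun t => S.op t f) (𝓝 0) (𝓝 f) := by
    have h1 : Tendsto (fun t => S.op t f) (𝓝[≥] 0) (𝓝 f) := by
      rw [← Ioi_insert, nhdsWithin_insert]
      refine Tendsto.sup ?_ (S.tendsto_zero f)
      rw [tendsto_pure_left]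
      intro s hs
      rw [S.op_zero]
      exact mem_of_mem_nhds hs
    have h2 : (Ici (0 : ℝ≥0)) = univ := by ext x; simp
    rwa [h2, nhdsWithin_univ] at h1
  have hle : ∀ s t : ℝ≥0, s ≤ t → ‖S.op t f - S.op s f‖ ≤ ‖S.op (t - s) f - f‖ := by
    intro s t hst
    have : S.op t f - S.op s f = S.op s (S.op (t - s) f - f) := by
      conv_lhs => rw [← add_tsub_cancel_of_le hst, S.op_add]
      rw [map_sub]; rfl
    rw [this]
    exact S.norm_op_apply_le _ _
  rw [continuous_iff_continuousAt]
  intro t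
  have hg : Tendsto (fun s : ℝ≥0 => ‖S.op (s - t) f - f‖ + ‖S.op (t - s) f - f‖) (𝓝 t) (𝓝 0) := by
    have e1 : Tendsto (fun s : ℝ≥0 => s - t) (𝓝 t) (𝓝 0) := by
      have : Continuous fun s : ℝ≥0 => s - t := by fun_prop
      simpa using this.tendsto t
    have e2 : Tendsto (fun s : ℝ≥0 => t - s) (𝓝 t) (𝓝 0) := by
      have : Continuous fun s : ℝ≥0 => t - s := by fun_prop
      simpa using this.tendsto t
    have n1 := ((h0.comp e1).sub_const f).norm
    have n2 := ((h0.comp e2).sub_const f).norm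
    simpa using n1.add n2
  rw [ContinuousAt, tendsto_iff_norm_sub_tendsto_zero]
  refine squeeze_zero (fun _ => norm_nonneg _) (fun s => ?_) hg
  rcases le_total t s with h | h
  · exact (hle t s h).trans (le_add_of_nonneg_right (norm_nonneg _))
  · rw [norm_sub_rev]
    exact (hle s t h).trans (le_add_of_nonneg_left (norm_nonneg _))

theorem integrableOn_resolvent (S : SymmetricL2Extension P m) (α : ℝ) (hα : 0 < α)
    (f : Lp ℝ 2 m) :
    IntegrableOn (fun s : ℝ => Real.exp (-α * s) • S.op s.toNNReal f) (Ioi 0) := by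
  have hcont : Continuous fun s : ℝ => Real.exp (-α * s) • S.op s.toNNReal f :=
    (show Continuous fun s : ℝ => Real.exp (-α * s) by fun_prop).smul
      ((S.continuous_op_apply f).comp continuous_real_toNNReal)
  refine Integrable.mono' ((exp_neg_integrableOn_Ioi 0 hα).mul_const ‖f‖)
    hcont.aestronglyMeasurable (Eventually.of_forall fun s => ?_)
  rw [norm_smul, Real.norm_eq_abs, abs_of_pos (Real.exp_pos _)]
  exact mul_le_mul_of_nonneg_left (S.norm_op_apply_le _ _) (Real.exp_pos _).le

theorem norm_resolvent_le (S : SymmetricL2Extension P m) (α : ℝ) (hα : 0 < α) (f : Lp ℝ 2 m) :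
    ‖∫ s in Ioi (0 : ℝ), Real.exp (-α * s) • S.op s.toNNReal f‖ ≤ α⁻¹ * ‖f‖ := by
  have h := norm_integral_le_of_norm_le ((exp_neg_integrableOn_Ioi 0 hα).mul_const ‖f‖)
    (f := fun s : ℝ => Real.exp (-α * s) • S.op s.toNNReal f)
    (Eventually.of_forall fun s => by
      rw [norm_smul, Real.norm_eq_abs, abs_of_pos (Real.exp_pos _)]
      exact mul_le_mul_of_nonneg_left (S.norm_op_apply_le _ _) (Real.exp_pos _).le)
  refine h.trans (le_of_eq ?_)
  rw [integral_mul_const, integral_exp_mul_Ioi (by linarith) 0]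
  simp [neg_div_neg_eq]

end Contraction

/-- The `α`-resolvent `U^α f = ∫₀^∞ e^{-αs} P_s f ds` (Bochner integral in `L²(m)`), as a bounded
operator on `L²(m)`. -/
noncomputable def resolvent {E : Type*} [MeasurableSpace E] {P : ℝ≥0 → Kernel E E}
    {m : Measure E} (S : SymmetricL2Extension P m) (α : ℝ) (hα : 0 < α) :
    Lp ℝ 2 m →L[ℝ] Lp ℝ 2 m :=
  LinearMap.mkContinuous
    { toFun := fun f => ∫ s in Ioi (0 : ℝ), Real.exp (-α * s) • S.op s.toNNReal f
      map_add' := fun f g => by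
        simp only [map_add, smul_add]
        exact integral_add (S.integrableOn_resolvent α hα f) (S.integrableOn_resolvent α hα g)
      map_smul' := fun c f => by
        simp only [map_smul, smul_comm _ c, RingHom.id_apply]
        exact integral_smul c _ }
    α⁻¹ (S.norm_resolvent_le α hα)

/-- The integrand `s ↦ J₀(2√(ts)) e^{-αs} P_s f` of `𝒥^α_t f`. -/
noncomputable def besselIntegrand {E : Type*} [MeasurableSpace E] {P : ℝ≥0 → Kernel E E}
    {m : Measure E} (S : SymmetricL2Extension P m) (α t : ℝ) (f : Lp ℝ 2 m) (s : ℝ) : Lp ℝ 2 m :=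
  (besselJ0 (2 * √(t * s)) * Real.exp (-α * s)) • S.op s.toNNReal f

/-- `𝒥^α_t f = ∫₀^∞ J₀(2√(ts)) e^{-αs} P_s f ds`, a Bochner integral in `L²(m)`. -/
noncomputable def besselTransform {E : Type*} [MeasurableSpace E] {P : ℝ≥0 → Kernel E E}
    {m : Measure E} (S : SymmetricL2Extension P m) (α t : ℝ) (f : Lp ℝ 2 m) : Lp ℝ 2 m :=
  ∫ s in Ioi (0 : ℝ), S.besselIntegrand α t f s

end SymmetricL2Extension

/-- `j : [0, ∞) → H` solves `dj/dt = -B j`, `j(0) = j₀`: the derivative is the norm derivative in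
`H` at every `t ≥ 0` (one-sided at `t = 0`). Values of `j` at negative times play no role. -/
def IsCauchySolution {H : Type*} [NormedAddCommGroup H] [NormedSpace ℝ H]
    (B : H →L[ℝ] H) (j₀ : H) (j : ℝ → H) : Prop :=
  j 0 = j₀ ∧ ∀ t, 0 ≤ t → HasDerivWithinAt j (-(B (j t))) (Ici 0) t

/-! Write `U` for the resolvent and `F s` for `e^{-αs} P_s f`. The semigroup law gives `U (F s) =
∫_s^∞ F`, so `s ↦ U (F s)` is a primitive of `-F`. Integrating by parts against `s^k/k!` and
inducting yields `U^{k+1} f = ∫_0^∞ (s^k/k!) F s ds` (`resolvent_moment`,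
`resolvent_pow_succ_apply`). Hence `e^{-tU} U f = ∑ (-t)^k/k! · U^{k+1} f` is the termwise integral
of `∑ (-ts)^k/(k!)² · F s`, whose sum is `J₀(2√(ts)) F s`.

Exchanging sum and integral rests on contractivity of `P_t` and on `s^k/k! · e^{-αs} ≤ (2/α)^k
e^{-αs/2}`: the majorant of the `k`-th term is a summable coefficient times a fixed integrable
function of `s`. The Cauchy problem is then that of a bounded generator: the exponential solves it,
and the Lipschitz vector field gives uniqueness. -/

/-! ### Linear Cauchy problems with bounded generator -/

/-- A solution of a linear Cauchy problem with bounded generator is given by the exponential. -/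
theorem isCauchySolution_exp {H : Type*} [NormedAddCommGroup H] [NormedSpace ℝ H]
    [CompleteSpace H] (B : H →L[ℝ] H) (j₀ : H) :
    IsCauchySolution B j₀ (fun t => NormedSpace.exp (-(t • B)) j₀) := by
  refine ⟨by simp, fun t _ => HasDerivAt.hasDerivWithinAt ?_⟩
  -- The primed derivative puts the generator to the left of the exponential, as the equation `j' =
  -- -B j` requires.
  have h := (hasDerivAt_exp_smul_const' (𝕂 := ℝ) (-B) t).clm_apply (hasDerivAt_const t j₀)
  simpa using h

/-- The exponential series of `-t B`, applied to a vector. -/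
theorem hasSum_exp_neg_smul_apply {H : Type*} [NormedAddCommGroup H] [NormedSpace ℝ H]
    [CompleteSpace H] (B : H →L[ℝ] H) (t : ℝ) (x : H) :
    HasSum (fun k : ℕ => ((-t) ^ k / k.factorial : ℝ) • (B ^ k) x)
      (NormedSpace.exp (-(t • B)) x) := by
  have h := (ContinuousLinearMap.apply ℝ H x).hasSum
    (NormedSpace.exp_series_hasSum_exp' (𝕂 := ℝ) (-(t • B)))
  refine h.congr_fun fun k => ?_
  rw [← neg_smul, smul_pow, smul_smul, inv_mul_eq_div]
  rfl

/-- Uniqueness for the Cauchy problem with a bounded generator. -/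
theorem IsCauchySolution.eq {H : Type*} [NormedAddCommGroup H] [NormedSpace ℝ H]
    {B : H →L[ℝ] H} {j₀ : H} {j k : ℝ → H} (hj : IsCauchySolution B j₀ j)
    (hk : IsCauchySolution B j₀ k) {t : ℝ} (ht : 0 ≤ t) : j t = k t := by
  have hcont : ∀ {l : ℝ → H}, IsCauchySolution B j₀ l → ContinuousOn l (Icc 0 t) :=
    fun hl s hs => (hl.2 s hs.1).continuousWithinAt.mono Icc_subset_Ici_self
  have hderiv : ∀ {l : ℝ → H}, IsCauchySolution B j₀ l →
      -- Uniqueness needs only right derivatives, which the derivative within `Ici 0` supplies at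
      -- every `s ≥ 0`.
      ∀ s ∈ Ico 0 t, HasDerivWithinAt l ((-B) (l s)) (Ici s) s :=
    fun hl s hs => (hl.2 s hs.1).mono (Ici_subset_Ici.2 hs.1)
  exact ODE_solution_unique (v := fun _ => ⇑(-B)) (fun _ => (-B).lipschitz) (hcont hj)
    (hderiv hj) (hcont hk) (hderiv hk) (hj.1.trans hk.1.symm) (right_mem_Icc.2 ht)

/-- Replacing a Cauchy solution on negative times does not matter. -/
theorem IsCauchySolution.congr {H : Type*} [NormedAddCommGroup H] [NormedSpace ℝ H]
    {B : H →L[ℝ] H} {j₀ : H} {j k : ℝ → H} (hj : IsCauchySolution B j₀ j)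
    (hjk : ∀ t, 0 ≤ t → k t = j t) : IsCauchySolution B j₀ k := by
  refine ⟨(hjk 0 le_rfl).trans hj.1, fun t ht => ?_⟩
  rw [hjk t ht]
  exact (hj.2 t ht).congr hjk (hjk t ht)

/-! ### Scalar estimates and the Bessel series -/

/-- Half of the exponential decay absorbs the power, through `x^k/k! ≤ e^x` at `x = αs/2`; the other
half stays integrable. The cost is only geometric in `k`. -/
theorem pow_div_factorial_mul_exp_neg_le {α : ℝ} (hα : 0 < α) (k : ℕ) {s : ℝ} (hs : 0 ≤ s) :
    s ^ k / k.factorial * Real.exp (-α * s) ≤ (2 / α) ^ k * Real.exp (-(α / 2) * s) := by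
  have h := Real.pow_div_factorial_le_exp (α / 2 * s) (by positivity) k
  have e : s ^ k / (k.factorial : ℝ) = (2 / α) ^ k * ((α / 2 * s) ^ k / k.factorial) := by
    rw [← mul_div_assoc, ← mul_pow]
    congr 2
    field_simp
  calc s ^ k / k.factorial * Real.exp (-α * s)
      ≤ (2 / α) ^ k * Real.exp (α / 2 * s) * Real.exp (-α * s) := by
        rw [e]; gcongr
    _ = (2 / α) ^ k * Real.exp (-(α / 2) * s) := by
        rw [mul_assoc, ← Real.exp_add]
        congr 2
        ring

/-- The power series of `x ↦ J₀(2√x)` at nonnegative `x`. -/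
theorem hasSum_besselJ0_two_mul_sqrt {x : ℝ} (hx : 0 ≤ x) :
    HasSum (fun k : ℕ => (-1) ^ k * x ^ k / (k.factorial : ℝ) ^ 2) (besselJ0 (2 * √x)) := by
  have e : ∀ k : ℕ, (-1 : ℝ) ^ k * (2 * √x / 2) ^ (2 * k) / (k.factorial : ℝ) ^ 2 =
      (-1) ^ k * x ^ k / (k.factorial : ℝ) ^ 2 := fun k => by
    rw [mul_div_cancel_left₀ _ (two_ne_zero), pow_mul, Real.sq_sqrt hx]
  have hs : Summable fun k : ℕ => (-1 : ℝ) ^ k * x ^ k / (k.factorial : ℝ) ^ 2 := by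
    -- Since `k! ≥ 1`, one of the two factorials can be dropped, leaving the exponential series as
    -- majorant.
    refine Summable.of_norm_bounded (Real.summable_pow_div_factorial x) fun k => ?_
    have h1 : (1 : ℝ) ≤ k.factorial := by exact_mod_cast k.factorial_pos
    rw [norm_div, norm_mul, norm_pow, norm_pow, norm_pow, norm_neg, norm_one, one_pow, one_mul,
      Real.norm_of_nonneg hx, Real.norm_of_nonneg (by positivity)]
    gcongr
    nlinarith
  rw [besselJ0, tsum_congr e]
  exact hs.hasSum

/-! ### Moments of the discounted orbit and powers of the resolvent -/

namespace SymmetricL2Extension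

section Moments

variable {E : Type*} [MeasurableSpace E] {P : ℝ≥0 → Kernel E E} {m : Measure E}

/-- The discounted orbit `s ↦ e^{-αs} P_s f`. -/
noncomputable def discountedOrbit (S : SymmetricL2Extension P m) (α : ℝ) (f : Lp ℝ 2 m)
    (s : ℝ) : Lp ℝ 2 m :=
  Real.exp (-α * s) • S.op s.toNNReal f

theorem continuous_discountedOrbit (S : SymmetricL2Extension P m) (α : ℝ) (f : Lp ℝ 2 m) :
    Continuous (S.discountedOrbit α f) :=
  (show Continuous fun s : ℝ => Real.exp (-α * s) by fun_prop).smul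
    ((S.continuous_op_apply f).comp continuous_real_toNNReal)

theorem norm_discountedOrbit_le (S : SymmetricL2Extension P m) (α : ℝ) (f : Lp ℝ 2 m) (s : ℝ) :
    ‖S.discountedOrbit α f s‖ ≤ Real.exp (-α * s) * ‖f‖ := by
  rw [discountedOrbit, norm_smul, Real.norm_of_nonneg (Real.exp_pos _).le]
  exact mul_le_mul_of_nonneg_left (S.norm_op_apply_le _ _) (Real.exp_pos _).le

/-- Semigroup law for the discounted orbit. Nonnegativity matters because `toNNReal` is additive
only there. -/
theorem discountedOrbit_discountedOrbit (S : SymmetricL2Extension P m) (α : ℝ) (f : Lp ℝ 2 m)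
    {r s : ℝ} (hr : 0 ≤ r) (hs : 0 ≤ s) :
    S.discountedOrbit α (S.discountedOrbit α f s) r = S.discountedOrbit α f (r + s) := by
  simp only [discountedOrbit]
  rw [map_smul, smul_smul, ← Real.exp_add, Real.toNNReal_add hr hs, S.op_add, mul_add]
  rfl

theorem resolvent_apply (S : SymmetricL2Extension P m) {α : ℝ} (hα : 0 < α) (f : Lp ℝ 2 m) :
    S.resolvent α hα f = ∫ s in Ioi (0 : ℝ), S.discountedOrbit α f s :=
  rfl

theorem norm_resolvent_apply_le (S : SymmetricL2Extension P m) {α : ℝ} (hα : 0 < α)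
    (f : Lp ℝ 2 m) : ‖S.resolvent α hα f‖ ≤ α⁻¹ * ‖f‖ :=
  S.norm_resolvent_le α hα f

/-- Shifting the integration variable by `s` turns the left side into the tail `∫_s^∞`. Writing the
tail as total minus an interval integral prepares it for the fundamental theorem of calculus. -/
theorem resolvent_discountedOrbit (S : SymmetricL2Extension P m) {α : ℝ} (hα : 0 < α)
    (f : Lp ℝ 2 m) {s : ℝ} (hs : 0 ≤ s) :
    S.resolvent α hα (S.discountedOrbit α f s) =
      S.resolvent α hα f - ∫ r in (0 : ℝ)..s, S.discountedOrbit α f r := by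
  have hint : IntegrableOn (S.discountedOrbit α f) (Ioi 0) := S.integrableOn_resolvent α hα f
  have h1 : S.resolvent α hα (S.discountedOrbit α f s) =
      ∫ r in Ioi s, S.discountedOrbit α f r := by
    have h := (measurePreserving_add_right volume s).setIntegral_preimage_emb
      (measurableEmbedding_addRight s) (S.discountedOrbit α f) (Ioi s)
    rw [preimage_add_const_Ioi, sub_self] at h
    rw [resolvent_apply, ← h]
    exact setIntegral_congr_fun measurableSet_Ioi fun r hr =>
      S.discountedOrbit_discountedOrbit α f (le_of_lt hr) hs
  rw [h1, resolvent_apply, eq_sub_iff_add_eq, add_comm]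
  exact intervalIntegral.integral_interval_add_Ioi hint (hint.mono_set (Ioi_subset_Ioi hs))

theorem hasDerivAt_resolvent_discountedOrbit (S : SymmetricL2Extension P m) {α : ℝ} (hα : 0 < α)
    (f : Lp ℝ 2 m) {s : ℝ} (hs : 0 < s) :
    HasDerivAt (fun r => S.resolvent α hα (S.discountedOrbit α f r))
      (-S.discountedOrbit α f s) s := by
  have hc := S.continuous_discountedOrbit α f
  have h := (intervalIntegral.integral_hasDerivAt_right (hc.intervalIntegrable 0 s)
    (hc.stronglyMeasurableAtFilter _ _) hc.continuousAt).const_sub (S.resolvent α hα f)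
  -- The integral formula holds only for `r ≥ 0`; at `s > 0` this covers a full neighbourhood.
  refine h.congr_of_eventuallyEq ?_
  filter_upwards [lt_mem_nhds hs] with r hr using S.resolvent_discountedOrbit hα f hr.le

theorem norm_moment_le (S : SymmetricL2Extension P m) {α : ℝ} (hα : 0 < α) (f : Lp ℝ 2 m)
    (k : ℕ) {s : ℝ} (hs : 0 ≤ s) :
    ‖(s ^ k / k.factorial : ℝ) • S.discountedOrbit α f s‖ ≤
      (2 / α) ^ k * Real.exp (-(α / 2) * s) * ‖f‖ := by
  rw [norm_smul, Real.norm_of_nonneg (by positivity)]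
  calc s ^ k / k.factorial * ‖S.discountedOrbit α f s‖
      ≤ s ^ k / k.factorial * (Real.exp (-α * s) * ‖f‖) := by
        gcongr; exact S.norm_discountedOrbit_le α f s
    _ ≤ (2 / α) ^ k * Real.exp (-(α / 2) * s) * ‖f‖ := by
        rw [← mul_assoc]
        exact mul_le_mul_of_nonneg_right (pow_div_factorial_mul_exp_neg_le hα k hs)
          (norm_nonneg _)

theorem integrableOn_moment (S : SymmetricL2Extension P m) {α : ℝ} (hα : 0 < α) (f : Lp ℝ 2 m)
    (k : ℕ) :
    IntegrableOn (fun s : ℝ => (s ^ k / k.factorial : ℝ) • S.discountedOrbit α f s) (Ioi 0) := by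
  have hc := S.continuous_discountedOrbit α f
  refine Integrable.mono' (((exp_neg_integrableOn_Ioi 0 (half_pos hα)).const_mul
    ((2 / α) ^ k)).mul_const ‖f‖)
    (by fun_prop : Continuous _).aestronglyMeasurable ?_
  filter_upwards [ae_restrict_mem measurableSet_Ioi] with s hs
  exact S.norm_moment_le hα f k (le_of_lt hs)

/-- Integration by parts: the resolvent raises the order of a moment of the orbit by one. -/
theorem resolvent_moment (S : SymmetricL2Extension P m) {α : ℝ} (hα : 0 < α) (f : Lp ℝ 2 m)
    (k : ℕ) :
    S.resolvent α hα (∫ s in Ioi (0 : ℝ), (s ^ k / k.factorial : ℝ) • S.discountedOrbit α f s) =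
      ∫ s in Ioi (0 : ℝ), (s ^ (k + 1) / (k + 1).factorial : ℝ) • S.discountedOrbit α f s := by
  set U := S.resolvent α hα
  set F := S.discountedOrbit α f
  have hF_cont : Continuous F := S.continuous_discountedOrbit α f
  have hint := S.integrableOn_moment hα f k
  have hint' := S.integrableOn_moment hα f (k + 1)
  have hUint : IntegrableOn (fun s : ℝ => (s ^ k / k.factorial : ℝ) • U (F s)) (Ioi 0) := by
    simpa only [map_smul] using! U.integrable_comp hint
  -- The derivative of this product is the difference of the integrands of the two sides, so the
  -- claim reduces to the vanishing of both boundary terms.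
  have hderiv : ∀ s ∈ Ioi (0 : ℝ), HasDerivAt
      (fun s : ℝ => (s ^ (k + 1) / (k + 1).factorial : ℝ) • U (F s))
      ((s ^ k / k.factorial : ℝ) • U (F s) - (s ^ (k + 1) / (k + 1).factorial : ℝ) • F s) s := by
    intro s hs
    have h1 : HasDerivAt (fun s : ℝ => s ^ (k + 1) / ((k + 1).factorial : ℝ))
        (s ^ k / k.factorial) s := by
      refine ((hasDerivAt_pow (k + 1) s).div_const ((k + 1).factorial : ℝ)).congr_deriv ?_
      rw [Nat.factorial_succ]
      push_cast
      field_simp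
    refine (h1.smul (S.hasDerivAt_resolvent_discountedOrbit hα f hs)).congr_deriv ?_
    rw [smul_neg, neg_add_eq_sub]
  have hlim : Tendsto (fun s : ℝ => (s ^ (k + 1) / (k + 1).factorial : ℝ) • U (F s))
      atTop (𝓝 0) := by
    have h0 : Tendsto (fun s : ℝ => α⁻¹ * ((2 / α) ^ (k + 1) * Real.exp (-(α / 2) * s) * ‖f‖))
        atTop (𝓝 0) := by
      have h2 : Tendsto (fun s : ℝ => -(α / 2) * s) atTop atBot :=
        tendsto_id.const_mul_atTop_of_neg (by linarith)
      simpa using (((Real.tendsto_exp_atBot.comp h2).const_mul ((2 / α) ^ (k + 1))).mul_const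
        ‖f‖).const_mul α⁻¹
    refine squeeze_zero_norm' ?_ h0
    filter_upwards [eventually_ge_atTop 0] with s hs
    rw [← map_smul]
    refine (S.norm_resolvent_apply_le hα _).trans ?_
    gcongr
    exact S.norm_moment_le hα f (k + 1) hs
  -- Differentiability is known only for `s > 0`, so continuity at `0` is supplied separately. The
  -- boundary term at `0` vanishes because the exponent `k + 1` is positive.
  have hparts := integral_Ioi_of_hasDerivAt_of_tendsto
    (by fun_prop : Continuous _).continuousWithinAt hderiv (hUint.sub hint') hlim
  rw [integral_sub hUint hint'] at hparts
  rw [← U.integral_comp_comm hint]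
  simp only [map_smul]
  simpa [sub_eq_zero] using hparts

/-- Powers of the resolvent as moments of the orbit. -/
theorem resolvent_pow_succ_apply (S : SymmetricL2Extension P m) {α : ℝ} (hα : 0 < α)
    (f : Lp ℝ 2 m) (k : ℕ) :
    (S.resolvent α hα ^ k) (S.resolvent α hα f) =
      ∫ s in Ioi (0 : ℝ), (s ^ k / k.factorial : ℝ) • S.discountedOrbit α f s := by
  induction k with
  | zero => simp [resolvent_apply]
  | succ k ih => rw [pow_succ', mul_apply_eq_comp, ih, S.resolvent_moment]

end Moments

/-! ### Termwise integration of the Bessel series -/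

section Bessel

variable {E : Type*} [MeasurableSpace E] {P : ℝ≥0 → Kernel E E} {m : Measure E}

/-- One `1/k!` is grouped with `(-t)^k`, as in the exponential series, and the other with `s^k`, as
in the moments. -/
theorem hasSum_besselIntegrand (S : SymmetricL2Extension P m) (α : ℝ) (f : Lp ℝ 2 m) {t s : ℝ}
    (ht : 0 ≤ t) (hs : 0 ≤ s) :
    HasSum (fun k : ℕ => ((-t) ^ k / k.factorial : ℝ) •
      (s ^ k / k.factorial : ℝ) • S.discountedOrbit α f s) (S.besselIntegrand α t f s) := by
  rw [besselIntegrand, mul_smul, ← discountedOrbit]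
  convert (hasSum_besselJ0_two_mul_sqrt (mul_nonneg ht hs)).smul_const
    (S.discountedOrbit α f s) using 2 with k
  rw [smul_smul]
  congr 1
  rw [mul_pow, neg_pow t]
  ring

/-- The bound separates into a summable function of `k` and an integrable function of `s`, which
serves both absolute convergence and dominated convergence. -/
theorem norm_besselTerm_le (S : SymmetricL2Extension P m) {α : ℝ} (hα : 0 < α) (f : Lp ℝ 2 m)
    {t s : ℝ} (ht : 0 ≤ t) (hs : 0 ≤ s) (k : ℕ) :
    ‖((-t) ^ k / k.factorial : ℝ) • (s ^ k / k.factorial : ℝ) • S.discountedOrbit α f s‖ ≤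
      (t * (2 / α)) ^ k / k.factorial * (Real.exp (-(α / 2) * s) * ‖f‖) := by
  rw [norm_smul, norm_div, norm_pow, norm_neg, Real.norm_of_nonneg ht,
    Real.norm_of_nonneg (Nat.cast_nonneg _)]
  calc t ^ k / k.factorial * ‖(s ^ k / k.factorial : ℝ) • S.discountedOrbit α f s‖
      ≤ t ^ k / k.factorial * ((2 / α) ^ k * Real.exp (-(α / 2) * s) * ‖f‖) := by
        gcongr; exact S.norm_moment_le hα f k hs
    _ = (t * (2 / α)) ^ k / k.factorial * (Real.exp (-(α / 2) * s) * ‖f‖) := by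
        rw [mul_pow]; ring

theorem integrable_exp_neg_half_mul {α : ℝ} (hα : 0 < α) (c : ℝ) :
    IntegrableOn (fun s : ℝ => Real.exp (-(α / 2) * s) * c) (Ioi 0) :=
  (exp_neg_integrableOn_Ioi 0 (half_pos hα)).mul_const c

theorem integrableOn_besselIntegrand (S : SymmetricL2Extension P m) {α : ℝ} (hα : 0 < α)
    (f : Lp ℝ 2 m) {t : ℝ} (ht : 0 ≤ t) : IntegrableOn (S.besselIntegrand α t f) (Ioi 0) := by
  have hsum : ∀ᵐ s : ℝ ∂volume.restrict (Ioi 0), HasSum (fun k : ℕ =>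
      ((-t) ^ k / k.factorial : ℝ) • (s ^ k / k.factorial : ℝ) • S.discountedOrbit α f s)
      (S.besselIntegrand α t f s) := by
    filter_upwards [ae_restrict_mem measurableSet_Ioi] with s hs
    exact S.hasSum_besselIntegrand α f ht (le_of_lt hs)
  have hc := S.continuous_discountedOrbit α f
  -- Measurability comes from the integrand being an a.e. limit of continuous partial sums, with no
  -- regularity of `besselJ0` needed.
  have hmeas : AEStronglyMeasurable (S.besselIntegrand α t f) (volume.restrict (Ioi 0)) :=
    aestronglyMeasurable_of_tendsto_ae atTop
      (fun n : ℕ => (by fun_prop : Continuous fun s : ℝ => ∑ k ∈ Finset.range n,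
        ((-t) ^ k / k.factorial : ℝ) • (s ^ k / k.factorial : ℝ) •
          S.discountedOrbit α f s).aestronglyMeasurable)
      (hsum.mono fun s hs => hs.tendsto_sum_nat)
  have hb := Real.summable_pow_div_factorial (t * (2 / α))
  refine Integrable.mono' ((integrable_exp_neg_half_mul hα ‖f‖).const_mul
    (∑' k : ℕ, (t * (2 / α)) ^ k / (k.factorial : ℝ))) hmeas ?_
  filter_upwards [hsum, ae_restrict_mem measurableSet_Ioi] with s hs hs0
  rw [← hs.tsum_eq, ← tsum_mul_right]
  exact tsum_of_norm_bounded (hb.mul_right _).hasSum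
    fun k => S.norm_besselTerm_le hα f ht (le_of_lt hs0) k

/-- Termwise integration of the Bessel series gives the exponential series of `-t U^α`. -/
theorem besselTransform_eq_exp (S : SymmetricL2Extension P m) {α : ℝ} (hα : 0 < α)
    (f : Lp ℝ 2 m) {t : ℝ} (ht : 0 ≤ t) :
    S.besselTransform α t f =
      NormedSpace.exp (-(t • S.resolvent α hα)) (S.resolvent α hα f) := by
  have hc := S.continuous_discountedOrbit α f
  have hb := Real.summable_pow_div_factorial (t * (2 / α))
  have h1 : HasSum (fun k : ℕ => ∫ s in Ioi (0 : ℝ), ((-t) ^ k / k.factorial : ℝ) •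
      (s ^ k / k.factorial : ℝ) • S.discountedOrbit α f s) (S.besselTransform α t f) := by
    refine hasSum_integral_of_dominated_convergence
      (fun (k : ℕ) (s : ℝ) => (t * (2 / α)) ^ k / k.factorial *
        (Real.exp (-(α / 2) * s) * ‖f‖))
      (fun k => (by fun_prop : Continuous _).aestronglyMeasurable) (fun k => ?_)
      (Eventually.of_forall fun s => hb.mul_right _) ?_ ?_
    · filter_upwards [ae_restrict_mem measurableSet_Ioi] with s hs
      exact S.norm_besselTerm_le hα f ht (le_of_lt hs) k
    · simp only [tsum_mul_right]
      exact (integrable_exp_neg_half_mul hα ‖f‖).const_mul _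
    · filter_upwards [ae_restrict_mem measurableSet_Ioi] with s hs
      exact S.hasSum_besselIntegrand α f ht (le_of_lt hs)
  -- The integrated terms are `(-t)^k/k! · U^k (U f)`, so both sides are sums of the same series.
  refine h1.unique ?_
  simp only [integral_smul, ← S.resolvent_pow_succ_apply hα]
  exact hasSum_exp_neg_smul_apply (S.resolvent α hα) t (S.resolvent α hα f)

end Bessel

end SymmetricL2Extension

theorem theorem2p5 {E : Type*} [MetricSpace E] [LocallyCompactSpace E]
    [TopologicalSpace.SeparableSpace E] [MeasurableSpace E] [BorelSpace E]
    (m : Measure E) [SigmaFinite m] [m.IsOpenPosMeasure]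
    (P : ℝ≥0 → Kernel E E) (_hP : IsSubMarkovTransitionFunction P)
    (S : SymmetricL2Extension P m) (α : ℝ) (hα : 0 < α) (f : Lp ℝ 2 m) :
    (∀ t, 0 ≤ t → IntegrableOn (S.besselIntegrand α t f) (Ioi 0)) ∧
    IsCauchySolution (S.resolvent α hα) (S.resolvent α hα f)
      (fun t => S.besselTransform α t f) ∧
    (∀ j : ℝ → Lp ℝ 2 m, IsCauchySolution (S.resolvent α hα) (S.resolvent α hα f) j →
      ∀ t, 0 ≤ t → j t = S.besselTransform α t f) ∧
    (∀ t, 0 ≤ t → S.besselTransform α t f =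
      NormedSpace.exp (-(t • S.resolvent α hα)) (S.resolvent α hα f)) := by
  have hexp := isCauchySolution_exp (S.resolvent α hα) (S.resolvent α hα f)
  have hsol : IsCauchySolution (S.resolvent α hα) (S.resolvent α hα f)
      (fun t => S.besselTransform α t f) :=
    -- The exponential solves the equation at all real `t`, but the Bessel transform is identified
    -- with it only for `t ≥ 0`.
    hexp.congr fun t ht => S.besselTransform_eq_exp hα f ht
  exact ⟨fun t ht => S.integrableOn_besselIntegrand hα f ht, hsol,
    fun j hj t ht => hj.eq hsol ht, fun t ht => S.besselTransform_eq_exp hα f ht⟩
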